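/- Let $(G,c)$ be an infinite resistance network: an infinite vertex set $G^0$ with conductances $c_{xy}=c_{yx}\in[0,\infty)$, $c_{xx}=0$, such that $c(x)=\sum_{y}c_{xy}<\infty$ for every $x$ and the graph with adjacency $x\sim y\iff c_{xy}>0$ is connected (vertices of infinite degree are allowed). The Laplacian is $(\Delta v)(x)=\sum_y c_{xy}(v(x)-v(y))$ and the energy of $v:G^0\to\mathbb R$ is $\mathcal E(v)=\frac12\sum_{x,y}c_{xy}(v(x)-v(y))^2\in[0,\infty]$. In a finite connected network the effective resistance between $x$ and $y$ is $v(x)-v(y)$, where $\Delta v=\delta_x-\delta_y$. For a finite set $H\subset G^0$, the free subnetwork $H^F$ has vertex set $H$ and the conductances of $G$; the wired subnetwork $H^W$ is obtained from it by adding one vertex $\infty_H$ and setting $c_{x\infty_H}=\sum_{y\notin H}c_{xy}$ for $x\in H$. An exhaustion is an increasing sequence $(G_k)$ of finite vertex sets with union $G^0$ whose induced subgraphs are connected. The free and the wired resistance are $$R^F(x,y)=\lim_{k\to\infty}R_{G_k^F}(x,y),\qquad R^W(x,y)=\lim_{k\to\infty}R_{G_k^W}(x,y),$$ and $R^{\mathrm{hrm}}(x,y)=R^F(x,y)-R^W(x,y)$.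 **Theorem.** Exhaustions exist, and for all vertices $x\neq y$ the two limits exist in $\mathbb R$ and do not depend on the exhaustion, and $0<R^W(x,y)\le R^F(x,y)$. With the convention $1/0=\infty$, the boundary resistance $$R^{\partial}(x,y):=\frac{1}{R^W(x,y)^{-1}-R^F(x,y)^{-1}}\in(0,\infty]$$ satisfies $$R^{\partial}(x,y)=\frac{R^W(x,y)\,R^F(x,y)}{R^{\mathrm{hrm}}(x,y)},$$ where the quotient is $\infty$ if $R^{\mathrm{hrm}}(x,y)=0$. In particular, if every harmonic function of finite energy on $(G,c)$ is constant, then $R^{\partial}(x,y)=\infty$. -/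

import Mathlib

open Filter Topology
open scoped ENNReal

/-- A weighted graph: symmetric nonnegative conductances without loops, with finite total
conductance `∑ y, c x y` at every vertex (infinite degree is allowed). The vertices `x` and `y`
are adjacent iff `0 < c x y`. -/
structure WeightedGraph (V : Type*) where
  /-- the conductance function -/
  c : V → V → ℝ
  nonneg : ∀ x y, 0 ≤ c x y
  symm : ∀ x y, c x y = c y x
  loopless : ∀ x, c x x = 0
  summable : ∀ x, Summable (c x)

namespace WeightedGraph

variable {V : Type*} (W : WeightedGraph V)

/-- The underlying graph, with `x` adjacent to `y` iff `0 < c x y`. -/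
def graph : SimpleGraph V where
  Adj x y := 0 < W.c x y
  symm := ⟨fun x y h => by rw [W.symm y x]; exact h⟩
  loopless := ⟨fun x h => by rw [W.loopless x] at h; exact lt_irrefl _ h⟩

/-- The Laplacian `(Δ v)(x) = ∑ y, c x y * (v x - v y)`. -/
noncomputable def laplacian (v : V → ℝ) (x : V) : ℝ :=
  ∑' y, W.c x y * (v x - v y)

/-- The energy `(1/2) ∑ x, ∑ y, c x y * (v x - v y) ^ 2`, a number in `[0, ∞]`. -/
noncomputable def energy (v : V → ℝ) : ℝ≥0∞ :=
  (1 / 2) * ∑' x, ∑' y, ENNReal.ofReal (W.c x y * (v x - v y) ^ 2)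

/-- The harmonic functions of finite energy. -/
def harm : Set (V → ℝ) :=
  {v | W.energy v < ∞ ∧ ∀ x, W.laplacian v x = 0}

open Classical in
/-- `v` is a voltage for the unit current inserted at `x` and withdrawn at `y`, that is,
`Δ v = δ_x - δ_y`. -/
def IsUnitVoltage (x y : V) (v : V → ℝ) : Prop :=
  ∀ z, W.laplacian v z = (if z = x then 1 else 0) - (if z = y then 1 else 0)

/-- The effective resistance between two vertices of a finite connected network: the voltage drop
`v x - v y` when `Δ v = δ_x - δ_y`. (On a finite connected network such a `v` exists and is unique
up to an additive constant.) -/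
noncomputable def effectiveResistance (x y : V) : ℝ :=
  (Classical.epsilon (W.IsUnitVoltage x y)) x - (Classical.epsilon (W.IsUnitVoltage x y)) y

/-- The free (that is, full) subnetwork on a finite set `H` of vertices. -/
def free (H : Finset V) : WeightedGraph H where
  c x y := W.c x y
  nonneg x y := W.nonneg x y
  symm x y := W.symm x y
  loopless x := W.loopless x
  summable _ := Summable.of_finite

/-- The conductances of the wired subnetwork: all vertices outside `H` are identified to the single
vertex `none`, and the edge from `x ∈ H` to `none` has conductance `∑ y ∉ H, c x y`. -/
noncomputable def wiredConductance (H : Finset V) : Option H → Option H → ℝ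
  | some x, some y => W.c x y
  | some x, none => ∑' y : {y : V // y ∉ H}, W.c x y
  | none, some x => ∑' y : {y : V // y ∉ H}, W.c x y
  | none, none => 0

/-- The wired subnetwork associated with a finite set `H` of vertices. -/
noncomputable def wired (H : Finset V) : WeightedGraph (Option H) where
  c := W.wiredConductance H
  nonneg x y := by
    cases x <;> cases y <;> simp only [wiredConductance]
    · exact le_rfl
    · exact tsum_nonneg fun _ => W.nonneg _ _
    · exact tsum_nonneg fun _ => W.nonneg _ _
    · exact W.nonneg _ _
  symm x y := by
    cases x <;> cases y <;> simp only [wiredConductance]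
    exact W.symm _ _
  loopless x := by
    cases x <;> simp only [wiredConductance]
    exact W.loopless _
  summable _ := Summable.of_finite

open Classical in
/-- The effective resistance between `x` and `y` in the free subnetwork on `H`
(`0` unless `x, y ∈ H`). -/
noncomputable def freeResistanceOn (H : Finset V) (x y : V) : ℝ :=
  if h : x ∈ H ∧ y ∈ H then (W.free H).effectiveResistance ⟨x, h.1⟩ ⟨y, h.2⟩ else 0

open Classical in
/-- The effective resistance between `x` and `y` in the wired subnetwork associated with `H`
(`0` unless `x, y ∈ H`). -/
noncomputable def wiredResistanceOn (H : Finset V) (x y : V) : ℝ :=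
  if h : x ∈ H ∧ y ∈ H then
    (W.wired H).effectiveResistance (some ⟨x, h.1⟩) (some ⟨y, h.2⟩) else 0

/-- An exhaustion: an increasing sequence of finite connected full subnetworks, given by their
vertex sets, whose union is the whole network. -/
structure Exhaustion where
  /-- the vertex set of the `k`-th subnetwork -/
  verts : ℕ → Finset V
  mono : Monotone verts
  connected : ∀ k, (W.graph.induce (verts k : Set V)).Connected
  exhausts : ∀ x, ∃ k, x ∈ verts k

/-- The free resistance: the common limit, over all exhaustions, of the effective resistances in
the free subnetworks. -/
noncomputable def freeResistance (x y : V) : ℝ :=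
  Classical.epsilon fun r : ℝ => ∀ G : W.Exhaustion,
    Tendsto (fun k => W.freeResistanceOn (G.verts k) x y) atTop (𝓝 r)

/-- The wired resistance: the common limit, over all exhaustions, of the effective resistances in
the wired subnetworks. -/
noncomputable def wiredResistance (x y : V) : ℝ :=
  Classical.epsilon fun r : ℝ => ∀ G : W.Exhaustion,
    Tendsto (fun k => W.wiredResistanceOn (G.verts k) x y) atTop (𝓝 r)

/-- The harmonic resistance `R^F - R^W`. -/
noncomputable def harmonicResistance (x y : V) : ℝ :=
  W.freeResistance x y - W.wiredResistance x y

/-- The boundary resistance `1 / (1 / R^W - 1 / R^F)`, a number in `[0, ∞]` with `1 / 0 = ∞`. -/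
noncomputable def boundaryResistance (x y : V) : ℝ≥0∞ :=
  (ENNReal.ofReal ((W.wiredResistance x y)⁻¹ - (W.freeResistance x y)⁻¹))⁻¹

end WeightedGraph

/-- A resistance network: a connected weighted graph. -/
structure ResistanceNetwork (V : Type*) extends WeightedGraph V where
  connected : toWeightedGraph.graph.Connected

/-! On a finite connected network the unit voltage `v` represents the functional `u ↦ u x - u y` in
the energy form. Hence the energy of `v` is the resistance `R`, and Cauchy–Schwarz gives `(u x - u
y) ^ 2 ≤ E(u) * R`. A test function with drop `r` and energy at most `r`, where `r ≥ 0`, therefore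
forces `R ≥ r` (`effectiveResistance_le`).

Three test functions give all comparisons. Restricting the voltage of a larger free subnetwork shows
that free resistances decrease; extending a wired voltage by its value at the extra vertex shows
that wired ones increase; restricting a wired voltage to the free subnetwork shows wired ≤ free. The
limits are thus an infimum and a supremum over all connected finite sets containing both vertices,
whatever the exhaustion, and the formula for the boundary resistance is algebra.

For the last claim, voltages grounded at `y` are bounded by the resistances, so they converge along
an ultrafilter (`exists_limit`). The free and wired limits have finite energy, the same Laplacian
`δ_x - δ_y`, and drops `R^F` and `R^W`. Their difference is harmonic of finite energy, so if it is
constant the drops agree. -/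

namespace WeightedGraph

/-! ### Finite networks: energy form, maximum principle, effective resistance -/

section Finite

variable {ι : Type*} [Fintype ι] (W : WeightedGraph ι)

theorem laplacian_eq_sum (v : ι → ℝ) (x : ι) :
    W.laplacian v x = ∑ y, W.c x y * (v x - v y) :=
  tsum_fintype _

/-- The bilinear form of the energy of a finite network. -/
noncomputable def dirichlet (u v : ι → ℝ) : ℝ :=
  (1 / 2) * ∑ x, ∑ y, W.c x y * ((u x - u y) * (v x - v y))

theorem sum_mul_laplacian (u v : ι → ℝ) :
    ∑ z, u z * W.laplacian v z = W.dirichlet u v := by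
  have h : ∑ z, u z * W.laplacian v z = ∑ x, ∑ y, W.c x y * (u x * (v x - v y)) := by
    refine Finset.sum_congr rfl fun x _ => ?_
    rw [laplacian_eq_sum, Finset.mul_sum]
    exact Finset.sum_congr rfl fun y _ => by ring
  have h' : ∑ z, u z * W.laplacian v z = -∑ x, ∑ y, W.c x y * (u y * (v x - v y)) := by
    rw [h, Finset.sum_comm, ← Finset.sum_neg_distrib]
    refine Finset.sum_congr rfl fun x _ => ?_
    rw [← Finset.sum_neg_distrib]
    exact Finset.sum_congr rfl fun y _ => by rw [W.symm y x]; ring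
  have hd : W.dirichlet u v = (1 / 2) * (∑ x, ∑ y, W.c x y * (u x * (v x - v y))
      - ∑ x, ∑ y, W.c x y * (u y * (v x - v y))) := by
    rw [dirichlet, ← Finset.sum_sub_distrib]
    congr 1
    refine Finset.sum_congr rfl fun x _ => ?_
    rw [← Finset.sum_sub_distrib]
    exact Finset.sum_congr rfl fun y _ => by ring
  rw [hd]
  linarith

theorem sum_laplacian (v : ι → ℝ) : ∑ z, W.laplacian v z = 0 := by
  simpa [dirichlet] using W.sum_mul_laplacian (fun _ => 1) v

theorem dirichlet_sub_const (u v : ι → ℝ) (a : ℝ) :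
    W.dirichlet (fun z => u z - a) v = W.dirichlet u v := by
  simp [dirichlet]

theorem dirichlet_self_nonneg (u : ι → ℝ) : 0 ≤ W.dirichlet u u :=
  mul_nonneg (by norm_num) <| Finset.sum_nonneg fun _ _ => Finset.sum_nonneg fun _ _ =>
    mul_nonneg (W.nonneg _ _) (mul_self_nonneg _)

theorem dirichlet_add_smul_self (u v : ι → ℝ) (t : ℝ) :
    W.dirichlet (fun z => u z + t * v z) (fun z => u z + t * v z) =
      W.dirichlet v v * (t * t) + 2 * W.dirichlet u v * t + W.dirichlet u u := by
  simp only [dirichlet, Finset.mul_sum, Finset.sum_mul, ← Finset.sum_add_distrib]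
  exact Finset.sum_congr rfl fun x _ => Finset.sum_congr rfl fun y _ => by ring

theorem dirichlet_sq_le (u v : ι → ℝ) :
    W.dirichlet u v ^ 2 ≤ W.dirichlet u u * W.dirichlet v v := by
  have h := discrim_le_zero (a := W.dirichlet v v) (b := 2 * W.dirichlet u v)
    (c := W.dirichlet u u) fun t => by
      rw [← dirichlet_add_smul_self]
      exact W.dirichlet_self_nonneg _
  rw [discrim] at h
  nlinarith

variable {W}

/-- The maximum principle on a finite connected network. -/
theorem le_of_laplacian_nonpos (hW : W.graph.Connected) {v : ι → ℝ} {x : ι}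
    (hv : ∀ z, z ≠ x → W.laplacian v z ≤ 0) (z : ι) : v z ≤ v x := by
  have : Nonempty ι := ⟨x⟩
  obtain ⟨m, hm⟩ := Finite.exists_max v
  -- Along a walk from a maximum point, either the maximal value propagates to the end `z`, or `x`
  -- is met on the way and attains it. For `z = x` both alternatives say the same.
  suffices h : ∀ z, W.graph.Reachable m z → v z = v m ∨ v x = v m by
    rcases h x (hW.preconnected m x) with h | h <;> rw [h] <;> exact hm z
  rintro z ⟨p⟩
  induction p with
  | nil => exact Or.inl rfl
  | @cons a b d hab p ih =>
    by_cases hax : a = x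
    · exact Or.inr (by rw [hax])
    have h0 : ∀ y ∈ Finset.univ, 0 ≤ W.c a y * (v a - v y) := fun y _ =>
      mul_nonneg (W.nonneg _ _) (sub_nonneg.2 (hm y))
    have h1 := hv a hax
    rw [laplacian_eq_sum] at h1
    have h2 := (Finset.sum_eq_zero_iff_of_nonneg h0).1
      (le_antisymm h1 (Finset.sum_nonneg h0)) b (Finset.mem_univ b)
    have h3 : v b = v a := by
      have := (mul_eq_zero.1 h2).resolve_left (ne_of_gt hab)
      linarith
    rw [← h3]
    exact ih fun y => h3 ▸ hm y

theorem laplacian_neg (v : ι → ℝ) (z : ι) :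
    W.laplacian (fun a => -v a) z = -W.laplacian v z := by
  simp only [laplacian_eq_sum, ← Finset.sum_neg_distrib]
  exact Finset.sum_congr rfl fun y _ => by ring

theorem laplacian_sub (u v : ι → ℝ) (z : ι) :
    W.laplacian (fun a => u a - v a) z = W.laplacian u z - W.laplacian v z := by
  simp only [laplacian_eq_sum, ← Finset.sum_sub_distrib]
  exact Finset.sum_congr rfl fun y _ => by ring

theorem eq_of_laplacian_eq_zero (hW : W.graph.Connected) {v : ι → ℝ}
    (hv : ∀ z, W.laplacian v z = 0) (x y : ι) : v x = v y :=
  le_antisymm (le_of_laplacian_nonpos hW (fun z _ => (hv z).le) x)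
    (le_of_laplacian_nonpos hW (fun z _ => (hv z).le) y)

/-- Adding `v y` to the Laplacian at `y` removes its kernel of constants, so the operator is
injective, hence surjective. Since Laplacians sum to zero, summing the equation gives `v y = 0`, and
the added term disappears. -/
theorem exists_isUnitVoltage (hW : W.graph.Connected) (x y : ι) :
    ∃ v, W.IsUnitVoltage x y v ∧ v y = 0 := by
  classical
  let T : (ι → ℝ) →ₗ[ℝ] (ι → ℝ) :=
    { toFun := fun v z => W.laplacian v z + if z = y then v y else 0
      map_add' := fun u v => by
        ext z
        simp only [laplacian_eq_sum, Pi.add_apply]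
        have : ∑ a, W.c z a * (u z + v z - (u a + v a)) =
            ∑ a, W.c z a * (u z - u a) + ∑ a, W.c z a * (v z - v a) := by
          rw [← Finset.sum_add_distrib]
          exact Finset.sum_congr rfl fun a _ => by ring
        rw [this]
        split_ifs <;> ring
      map_smul' := fun t v => by
        ext z
        simp only [laplacian_eq_sum, Pi.smul_apply, smul_eq_mul, RingHom.id_apply, mul_add,
          Finset.mul_sum, mul_ite, mul_zero]
        congr 1
        exact Finset.sum_congr rfl fun a _ => by ring }
  have hT : ∀ v z, T v z = W.laplacian v z + if z = y then v y else 0 := fun _ _ => rfl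
  have hsum : ∀ v, ∑ z, T v z = v y := fun v => by
    simp [hT, Finset.sum_add_distrib, sum_laplacian]
  have hinj : Function.Injective T := by
    rw [injective_iff_map_eq_zero]
    intro v hv
    have hy : v y = 0 := by rw [← hsum v, hv]; simp
    have h0 : ∀ z, W.laplacian v z = 0 := fun z => by
      have := congrFun hv z
      simpa [hT, hy] using this
    ext z
    rw [eq_of_laplacian_eq_zero hW h0 z y, hy, Pi.zero_apply]
  obtain ⟨v, hv⟩ := LinearMap.surjective_of_injective hinj
    (fun z => (if z = x then (1 : ℝ) else 0) - if z = y then 1 else 0)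
  have hy : v y = 0 := by rw [← hsum v, hv]; simp
  refine ⟨v, fun z => ?_, hy⟩
  have := congrFun hv z
  rw [hT, hy] at this
  simpa using this

namespace IsUnitVoltage

variable {x y : ι} {v : ι → ℝ}

theorem dirichlet_eq (hv : W.IsUnitVoltage x y v) (u : ι → ℝ) :
    W.dirichlet u v = u x - u y := by
  classical
  rw [← sum_mul_laplacian]
  have h : ∀ z, W.laplacian v z = (if z = x then (1 : ℝ) else 0) - if z = y then 1 else 0 :=
    fun z => by rw [hv z]
  simp [h, mul_sub]

theorem effectiveResistance_eq (hW : W.graph.Connected) (hv : W.IsUnitVoltage x y v) :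
    W.effectiveResistance x y = v x - v y := by
  have hw : W.IsUnitVoltage x y (Classical.epsilon (W.IsUnitVoltage x y)) :=
    Classical.epsilon_spec ⟨v, hv⟩
  rw [effectiveResistance]
  have := eq_of_laplacian_eq_zero hW (v := fun z => Classical.epsilon (W.IsUnitVoltage x y) z - v z)
    (fun z => by rw [laplacian_sub, hw z, hv z, sub_self]) x y
  linarith

theorem dirichlet_self (hW : W.graph.Connected) (hv : W.IsUnitVoltage x y v) :
    W.dirichlet v v = W.effectiveResistance x y := by
  rw [hv.dirichlet_eq, hv.effectiveResistance_eq hW]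

theorem le_left (hW : W.graph.Connected) (hv : W.IsUnitVoltage x y v) (z : ι) : v z ≤ v x :=
  le_of_laplacian_nonpos hW (fun a ha => by rw [hv a, if_neg ha]; split_ifs <;> norm_num) z

theorem right_le (hW : W.graph.Connected) (hv : W.IsUnitVoltage x y v) (z : ι) : v y ≤ v z := by
  have := le_of_laplacian_nonpos hW (v := fun a => -v a) (x := y) (fun a ha => by
    rw [laplacian_neg, hv a, if_neg ha]; split_ifs <;> norm_num) z
  linarith

/-- The uniform bound behind the compactness argument: a voltage grounded at `y` takes its values
between `0` and the resistance. -/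
theorem abs_le (hW : W.graph.Connected) (hv : W.IsUnitVoltage x y v) (hy : v y = 0) (z : ι) :
    |v z| ≤ W.effectiveResistance x y := by
  have h1 := hv.le_left hW z
  have h2 := hv.right_le hW z
  rw [hv.effectiveResistance_eq hW, abs_of_nonneg (by linarith)]
  linarith

end IsUnitVoltage

/-- Cauchy–Schwarz against the unit voltage, whose energy is the resistance. -/
theorem sq_sub_le (hW : W.graph.Connected) (x y : ι) (u : ι → ℝ) :
    (u x - u y) ^ 2 ≤ W.dirichlet u u * W.effectiveResistance x y := by
  obtain ⟨v, hv, -⟩ := exists_isUnitVoltage hW x y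
  rw [← hv.dirichlet_self hW, ← hv.dirichlet_eq]
  exact W.dirichlet_sq_le u v

theorem effectiveResistance_nonneg (hW : W.graph.Connected) (x y : ι) :
    0 ≤ W.effectiveResistance x y := by
  obtain ⟨v, hv, -⟩ := exists_isUnitVoltage hW x y
  rw [← hv.dirichlet_self hW]
  exact W.dirichlet_self_nonneg v

theorem effectiveResistance_pos (hW : W.graph.Connected) {x y : ι} (hxy : x ≠ y) :
    0 < W.effectiveResistance x y := by
  classical
  refine lt_of_le_of_ne (effectiveResistance_nonneg hW x y) fun h => ?_
  have := sq_sub_le hW x y (Pi.single x 1)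
  rw [← h, mul_zero, Pi.single_eq_same, Pi.single_eq_of_ne' hxy] at this
  norm_num at this

/-- Resistances are compared by testing one network with the voltage of another. -/
theorem effectiveResistance_le {κ : Type*} [Fintype κ] {Z : WeightedGraph κ}
    (hW : W.graph.Connected) {x y : ι} {a b : κ} {r : ℝ} (u : κ → ℝ) (hZ : Z.graph.Connected)
    (hr : W.effectiveResistance x y = r)
    (hu : u a - u b = r) (hE : Z.dirichlet u u ≤ r) : r ≤ Z.effectiveResistance a b := by
  have h0 : 0 ≤ r := hr ▸ effectiveResistance_nonneg hW x y
  have h1 := effectiveResistance_nonneg hZ a b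
  have h2 := sq_sub_le hZ a b u
  rw [hu] at h2
  by_contra! h
  nlinarith [mul_le_mul_of_nonneg_right hE h1]

end Finite

end WeightedGraph

/-! ### Free and wired subnetworks: monotonicity of the resistances -/

namespace WeightedGraph

variable {V : Type*} {W : WeightedGraph V} {H H' : Finset V} {x y : V}

theorem free_graph_connected (hH : (W.graph.induce (H : Set V)).Connected) :
    (W.free H).graph.Connected :=
  hH

theorem exists_adj_notMem [Infinite V] (hW : W.graph.Connected) (hH : H.Nonempty) :
    ∃ a ∈ H, ∃ b ∉ H, 0 < W.c a b := by
  obtain ⟨a, ha⟩ := hH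
  obtain ⟨b, hb⟩ := Infinite.exists_notMem_finset H
  obtain ⟨p⟩ := hW.preconnected a b
  obtain ⟨d, -, h1, h2⟩ := p.exists_boundary_dart (H : Set V) ha hb
  exact ⟨d.fst, h1, d.snd, h2, d.adj⟩

/-- Infinitude of `V` matters: some edge must leave `H`, as otherwise the additional vertex would be
isolated. -/
theorem wired_graph_connected [Infinite V] (hW : W.graph.Connected)
    (hH : (W.graph.induce (H : Set V)).Connected) : (W.wired H).graph.Connected := by
  obtain ⟨⟨o, ho⟩⟩ := hH.nonempty
  obtain ⟨a, ha, b, hb, hab⟩ := exists_adj_notMem hW ⟨o, ho⟩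
  have hna : (W.wired H).graph.Adj (some ⟨a, ha⟩) none := by
    have hs : Summable fun y : {y : V // y ∉ H} => W.c a y :=
      (W.summable a).comp_injective Subtype.val_injective
    exact hs.tsum_pos (fun _ => W.nonneg _ _) ⟨b, hb⟩ hab
  let φ : (W.free H).graph →g (W.wired H).graph := ⟨some, fun h => h⟩
  have hsome : ∀ z : H, (W.wired H).graph.Reachable (some ⟨a, ha⟩) (some z) := fun z =>
    ((free_graph_connected hH).preconnected ⟨a, ha⟩ z).map φ
  have hall : ∀ z, (W.wired H).graph.Reachable (some ⟨a, ha⟩) z := fun z => by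
    cases z with
    | none => exact hna.reachable
    | some z => exact hsome z
  exact ⟨fun u v => (hall u).symm.trans (hall v)⟩

theorem freeResistanceOn_eq (hx : x ∈ H) (hy : y ∈ H) :
    W.freeResistanceOn H x y = (W.free H).effectiveResistance ⟨x, hx⟩ ⟨y, hy⟩ :=
  dif_pos ⟨hx, hy⟩

theorem wiredResistanceOn_eq (hx : x ∈ H) (hy : y ∈ H) :
    W.wiredResistanceOn H x y =
      (W.wired H).effectiveResistance (some ⟨x, hx⟩) (some ⟨y, hy⟩) :=
  dif_pos ⟨hx, hy⟩

theorem free_dirichlet_self (u : V → ℝ) :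
    (W.free H).dirichlet (fun z => u z) (fun z => u z) =
      (1 / 2) * ∑ p ∈ H ×ˢ H, W.c p.1 p.2 * (u p.1 - u p.2) ^ 2 := by
  rw [dirichlet, Finset.sum_product]
  congr 1
  rw [← Finset.sum_coe_sort H]
  refine Finset.sum_congr rfl fun a _ => ?_
  rw [← Finset.sum_coe_sort H]
  refine Finset.sum_congr rfl fun b _ => ?_
  rw [sq]
  rfl

theorem free_dirichlet_mono (hHH : H ⊆ H') (u : V → ℝ) :
    (W.free H).dirichlet (fun z => u z) (fun z => u z) ≤
      (W.free H').dirichlet (fun z => u z) (fun z => u z) := by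
  rw [free_dirichlet_self, free_dirichlet_self]
  refine mul_le_mul_of_nonneg_left ?_ (by norm_num)
  exact Finset.sum_le_sum_of_subset_of_nonneg (Finset.product_subset_product hHH hHH)
    fun p _ _ => mul_nonneg (W.nonneg _ _) (sq_nonneg _)

theorem free_dirichlet_le_wired (w : Option H → ℝ) :
    (W.free H).dirichlet (fun z => w (some z)) (fun z => w (some z)) ≤
      (W.wired H).dirichlet w w := by
  rw [dirichlet, dirichlet]
  refine mul_le_mul_of_nonneg_left ?_ (by norm_num)
  have h0 : ∀ a b, 0 ≤ (W.wired H).c a b * ((w a - w b) * (w a - w b)) := fun a b =>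
    mul_nonneg ((W.wired H).nonneg _ _) (mul_self_nonneg _)
  rw [Fintype.sum_option]
  refine le_add_of_nonneg_of_le (Finset.sum_nonneg fun _ _ => h0 _ _) ?_
  refine Finset.sum_le_sum fun a _ => ?_
  rw [Fintype.sum_option]
  exact le_add_of_nonneg_of_le (h0 _ _) le_rfl

open Classical in
/-- The function on the whole network which extends a function on the wired subnetwork by its value
at the additional vertex. -/
noncomputable def extend (H : Finset V) (w : Option H → ℝ) (z : V) : ℝ :=
  if h : z ∈ H then w (some ⟨z, h⟩) else w none

theorem extend_of_mem (w : Option H → ℝ) {z : V} (hz : z ∈ H) :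
    extend H w z = w (some ⟨z, hz⟩) :=
  dif_pos hz

theorem extend_of_notMem (w : Option H → ℝ) {z : V} (hz : z ∉ H) : extend H w z = w none :=
  dif_neg hz

theorem extend_some (w : Option H → ℝ) (z : H) : extend H w z = w (some z) :=
  extend_of_mem w z.2

theorem summable_laplacian_extend (w : Option H → ℝ) (z : V) :
    Summable fun y => W.c z y * (extend H w z - extend H w y) := by
  -- Relative to the value `w none`, the extension has support in the finite set `H`; the remaining
  -- part is a constant times `c z`.
  have h : Summable fun y => W.c z y * (w none - extend H w y) := by
    refine summable_of_hasFiniteSupport (H.finite_toSet.subset fun y hy => ?_)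
    by_contra h
    exact hy (by simp only [extend_of_notMem w h, sub_self, mul_zero])
  exact (((W.summable z).mul_right (extend H w z - w none)).add h).congr fun y => by ring

/-- The extension is constant off `H`, so the tail of the series collapses to the single term of the
wired edge. -/
theorem laplacian_extend (w : Option H → ℝ) (z : H) :
    W.laplacian (extend H w) z = (W.wired H).laplacian w (some z) := by
  rw [(W.wired H).laplacian_eq_sum, Fintype.sum_option, laplacian,
    ← (summable_laplacian_extend w z.1).sum_add_tsum_subtype_compl H, add_comm]
  congr 1
  · change _ = (∑' y : {y : V // y ∉ H}, W.c z y) * _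
    rw [← tsum_mul_right]
    refine tsum_congr fun y => ?_
    rw [extend_some, extend_of_notMem w y.2]
  · rw [← Finset.sum_coe_sort H]
    refine Finset.sum_congr rfl fun y _ => ?_
    rw [extend_some, extend_some]
    rfl

/-- Extending a function by its value at the additional vertex to a larger wired subnetwork preserves
the energy. -/
theorem wired_dirichlet_extend (hHH : H ⊆ H') (w : Option H → ℝ) :
    (W.wired H').dirichlet (fun z => z.elim (w none) fun a => extend H w a)
      (fun z => z.elim (w none) fun a => extend H w a) = (W.wired H).dirichlet w w := by
  classical
  set u : Option H' → ℝ := fun z => z.elim (w none) fun a => extend H w a with hu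
  have hext : extend H' u = extend H w := by
    ext z
    by_cases hz : z ∈ H'
    · rw [extend_of_mem u hz]; rfl
    · rw [extend_of_notMem u hz, extend_of_notMem w fun h => hz (hHH h)]; rfl
  -- Once `w none` is subtracted, both energies become sums of function times Laplacian. Only
  -- vertices of `H` contribute, and there both Laplacians are that of the common extension to `V`.
  rw [← dirichlet_sub_const _ u u (w none), ← dirichlet_sub_const _ w w (w none),
    ← sum_mul_laplacian, ← sum_mul_laplacian, Fintype.sum_option, Fintype.sum_option]
  have h1 : u none = w none := rfl
  rw [h1, sub_self, zero_mul, zero_mul, zero_add, zero_add]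
  have h2 : ∀ z : H', (u (some z) - w none) * (W.wired H').laplacian u (some z) =
      (extend H w z - w none) * W.laplacian (extend H w) z := fun z => by
    rw [← laplacian_extend, hext]
    rfl
  have h3 : ∀ z : H, (w (some z) - w none) * (W.wired H).laplacian w (some z) =
      (extend H w z - w none) * W.laplacian (extend H w) z := fun z => by
    rw [← laplacian_extend, extend_some]
  simp only [h2, h3]
  rw [Finset.sum_coe_sort H fun z => (extend H w z - w none) * W.laplacian (extend H w) z,
    Finset.sum_coe_sort H' fun z => (extend H w z - w none) * W.laplacian (extend H w) z]
  refine (Finset.sum_subset hHH fun z _ hz => ?_).symm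
  rw [extend_of_notMem w hz, sub_self, zero_mul]

theorem freeResistanceOn_anti (hH : (W.graph.induce (H : Set V)).Connected)
    (hH' : (W.graph.induce (H' : Set V)).Connected) (hHH : H ⊆ H') (hx : x ∈ H) (hy : y ∈ H) :
    W.freeResistanceOn H' x y ≤ W.freeResistanceOn H x y := by
  obtain ⟨v, hv, -⟩ := exists_isUnitVoltage (free_graph_connected hH') ⟨x, hHH hx⟩ ⟨y, hHH hy⟩
  have hH0 := free_graph_connected hH
  have hH0' := free_graph_connected hH'
  rw [freeResistanceOn_eq hx hy, freeResistanceOn_eq (hHH hx) (hHH hy)]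
  -- The value `0` off `H'` is arbitrary; only the restrictions to `H` and `H'` are used.
  let u : V → ℝ := extend H' fun z => z.elim 0 v
  have huv : (fun z : H' => u z) = v := funext fun z => extend_some _ z
  refine effectiveResistance_le hH0' (fun z : H => u z) hH0 rfl ?_ ?_
  · rw [hv.effectiveResistance_eq hH0', ← huv]
  · rw [← hv.dirichlet_self hH0', ← huv]
    exact free_dirichlet_mono hHH u

theorem wiredResistanceOn_mono [Infinite V] (hW : W.graph.Connected)
    (hH : (W.graph.induce (H : Set V)).Connected)
    (hH' : (W.graph.induce (H' : Set V)).Connected) (hHH : H ⊆ H') (hx : x ∈ H) (hy : y ∈ H) :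
    W.wiredResistanceOn H x y ≤ W.wiredResistanceOn H' x y := by
  have hH0 := wired_graph_connected hW hH
  obtain ⟨w, hw, -⟩ := exists_isUnitVoltage hH0 (some ⟨x, hx⟩) (some ⟨y, hy⟩)
  rw [wiredResistanceOn_eq hx hy, wiredResistanceOn_eq (hHH hx) (hHH hy)]
  refine effectiveResistance_le hH0 (fun z => z.elim (w none) fun a => extend H w a)
    (wired_graph_connected hW hH') rfl ?_ ?_
  · rw [hw.effectiveResistance_eq hH0, ← extend_of_mem w hx, ← extend_of_mem w hy]
    rfl
  · rw [wired_dirichlet_extend hHH w, hw.dirichlet_self hH0]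

theorem wiredResistanceOn_le_freeResistanceOn [Infinite V] (hW : W.graph.Connected)
    (hH : (W.graph.induce (H : Set V)).Connected) (hx : x ∈ H) (hy : y ∈ H) :
    W.wiredResistanceOn H x y ≤ W.freeResistanceOn H x y := by
  have hH0 := wired_graph_connected hW hH
  obtain ⟨w, hw, -⟩ := exists_isUnitVoltage hH0 (some ⟨x, hx⟩) (some ⟨y, hy⟩)
  rw [wiredResistanceOn_eq hx hy, freeResistanceOn_eq hx hy]
  refine effectiveResistance_le hH0 (fun z => w (some z)) (free_graph_connected hH) rfl ?_ ?_
  · rw [hw.effectiveResistance_eq hH0]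
  · exact (free_dirichlet_le_wired w).trans (hw.dirichlet_self hH0).le

theorem wiredResistanceOn_pos [Infinite V] (hW : W.graph.Connected)
    (hH : (W.graph.induce (H : Set V)).Connected) (hx : x ∈ H) (hy : y ∈ H) (hxy : x ≠ y) :
    0 < W.wiredResistanceOn H x y := by
  rw [wiredResistanceOn_eq hx hy]
  exact effectiveResistance_pos (wired_graph_connected hW hH) (by simpa using hxy)

open Classical in
-- The indicator of `H` turns the free Laplacian into a series over `V`. The wired analogue has
-- weight `1` instead, so one limit argument covers both.
theorem exists_free_voltage (hH : (W.graph.induce (H : Set V)).Connected)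
    (hx : x ∈ H) (hy : y ∈ H) :
    ∃ f : V → ℝ, f x - f y = W.freeResistanceOn H x y ∧
      (∀ z, |f z| ≤ W.freeResistanceOn H x y) ∧
      ∑ p ∈ H ×ˢ H, W.c p.1 p.2 * (f p.1 - f p.2) ^ 2 ≤ 2 * W.freeResistanceOn H x y ∧
      ∀ z ∈ H, ∑' a, W.c z a * ((if a ∈ H then 1 else 0) * (f z - f a)) =
        (if z = x then 1 else 0) - (if z = y then 1 else 0) := by
  have hH0 := free_graph_connected hH
  obtain ⟨v, hv, hvy⟩ := exists_isUnitVoltage hH0 ⟨x, hx⟩ ⟨y, hy⟩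
  rw [freeResistanceOn_eq hx hy]
  let u : V → ℝ := extend H fun z => z.elim 0 v
  have hu : ∀ z : H, u z = v z := fun z => extend_some _ z
  have huv : (fun z : H => u z) = v := funext hu
  refine ⟨u, ?_, fun z => ?_, ?_, fun z hz => ?_⟩
  · rw [hv.effectiveResistance_eq hH0, ← huv]
  · by_cases hz : z ∈ H
    · exact (hu ⟨z, hz⟩).symm ▸ hv.abs_le hH0 hvy ⟨z, hz⟩
    · rw [show u z = 0 from extend_of_notMem _ hz, abs_zero]
      exact effectiveResistance_nonneg hH0 _ _
  · have := free_dirichlet_self (W := W) (H := H) u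
    rw [huv, hv.dirichlet_self hH0] at this
    linarith
  · have h := hv ⟨z, hz⟩
    rw [laplacian_eq_sum, ← huv] at h
    rw [tsum_eq_sum (s := H) fun a ha => by rw [if_neg ha]; ring, ← Finset.sum_coe_sort H]
    simp only [Subtype.mk.injEq] at h
    refine Eq.trans (Finset.sum_congr rfl fun a _ => ?_) h
    rw [if_pos a.2, one_mul]
    rfl

open Classical in
theorem exists_wired_voltage [Infinite V] (hW : W.graph.Connected)
    (hH : (W.graph.induce (H : Set V)).Connected) (hx : x ∈ H) (hy : y ∈ H) :
    ∃ f : V → ℝ, f x - f y = W.wiredResistanceOn H x y ∧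
      (∀ z, |f z| ≤ W.wiredResistanceOn H x y) ∧
      ∑ p ∈ H ×ˢ H, W.c p.1 p.2 * (f p.1 - f p.2) ^ 2 ≤ 2 * W.wiredResistanceOn H x y ∧
      ∀ z ∈ H, ∑' a, W.c z a * (1 * (f z - f a)) =
        (if z = x then 1 else 0) - (if z = y then 1 else 0) := by
  have hH0 := wired_graph_connected hW hH
  obtain ⟨w, hw, hwy⟩ := exists_isUnitVoltage hH0 (some ⟨x, hx⟩) (some ⟨y, hy⟩)
  rw [wiredResistanceOn_eq hx hy]
  refine ⟨extend H w, ?_, fun z => ?_, ?_, fun z hz => ?_⟩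
  · rw [hw.effectiveResistance_eq hH0, extend_of_mem w hx, extend_of_mem w hy]
  · by_cases hz : z ∈ H
    · exact (extend_of_mem w hz).symm ▸ hw.abs_le hH0 hwy _
    · exact (extend_of_notMem w hz).symm ▸ hw.abs_le hH0 hwy _
  · have h1 := free_dirichlet_self (W := W) (H := H) (extend H w)
    have h2 := free_dirichlet_le_wired (W := W) w
    simp only [extend_some] at h1
    rw [hw.dirichlet_self hH0] at h2
    linarith
  · simp only [one_mul]
    have h := hw (some ⟨z, hz⟩)
    rw [← laplacian_extend] at h
    simpa [laplacian] using h

end WeightedGraph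

/-! ### Compactness, finite energy, exhaustions -/

namespace WeightedGraph

variable {V : Type*} {W : WeightedGraph V}

/-- A compactness principle: from uniformly bounded functions with prescribed Laplacians on
growing subnetworks and locally bounded energies one obtains, along an ultrafilter, a limit of finite
energy with the prescribed Laplacian. The weights `m k` single out the subnetworks. -/
theorem exists_limit (U : Ultrafilter ℕ) {f m : ℕ → V → ℝ} {d : V → ℝ} {B : ℝ}
    (hf : ∀ᶠ k in U, ∀ z, |f k z| ≤ B)
    (hm : ∀ k z, |m k z| ≤ 1) (hm1 : ∀ z, ∀ᶠ k in U, m k z = 1)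
    (hE : ∀ s : Finset (V × V), ∀ᶠ k in U, ∑ p ∈ s, W.c p.1 p.2 * (f k p.1 - f k p.2) ^ 2 ≤ B)
    (hL : ∀ z, ∀ᶠ k in U, ∑' a, W.c z a * (m k a * (f k z - f k a)) = d z) :
    ∃ v : V → ℝ, (∀ z, Tendsto (fun k => f k z) U (𝓝 (v z))) ∧ W.energy v < ∞ ∧
      ∀ z, HasSum (fun a => W.c z a * (v z - v a)) (d z) := by
  -- An ultrafilter on a compact interval converges, at all vertices simultaneously, without a
  -- diagonal subsequence.
  have hlim : ∀ z, ∃ r ∈ Set.Icc (-B) B, Tendsto (fun k => f k z) U (𝓝 r) := fun z => by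
    refine isCompact_Icc.ultrafilter_le_nhds (U.map fun k => f k z) ?_
    rw [le_principal_iff]
    change ∀ᶠ k in (U : Filter ℕ), f k z ∈ Set.Icc (-B) B
    filter_upwards [hf] with k hk
    exact abs_le.1 (hk z)
  choose v hvB hv using hlim
  have hvB' : ∀ z, |v z| ≤ B := fun z => abs_le.2 (hvB z)
  have hdiff : ∀ z a, Tendsto (fun k => f k z - f k a) U (𝓝 (v z - v a)) := fun z a =>
    (hv z).sub (hv a)
  refine ⟨v, hv, ?_, fun z => ?_⟩
  · have hs : ∀ s : Finset (V × V), ∑ p ∈ s, W.c p.1 p.2 * (v p.1 - v p.2) ^ 2 ≤ B := fun s =>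
      le_of_tendsto (tendsto_finsetSum s fun p _ => ((hdiff p.1 p.2).pow 2).const_mul _) (hE s)
    refine ENNReal.mul_lt_top (by simp) (lt_of_le_of_lt ?_ (ENNReal.ofReal_lt_top (r := B)))
    rw [← ENNReal.tsum_prod (f := fun x y => ENNReal.ofReal (W.c x y * (v x - v y) ^ 2)),
      ENNReal.tsum_eq_iSup_sum]
    refine iSup_le fun s => ?_
    rw [← ENNReal.ofReal_sum_of_nonneg fun p _ => mul_nonneg (W.nonneg _ _) (sq_nonneg _)]
    exact ENNReal.ofReal_le_ofReal (hs s)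
  · have hbound : Summable fun a => W.c z a * (2 * B) := (W.summable z).mul_right _
    have hsub : ∀ g : V → ℝ, (∀ a, |g a| ≤ B) → ∀ a, |g z - g a| ≤ 2 * B := fun g hg a =>
      (abs_sub _ _).trans (by linarith [hg z, hg a])
    have hsum : Summable fun a => W.c z a * (v z - v a) :=
      hbound.of_norm_bounded fun a => by
        rw [Real.norm_eq_abs, abs_mul, abs_of_nonneg (W.nonneg z a)]
        exact mul_le_mul_of_nonneg_left (hsub v hvB' a) (W.nonneg z a)
    -- Vertices may have infinite degree, so the limit passes through the series by domination with
    -- `2 * B * c z a`.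
    have hT : Tendsto (fun k => ∑' a, W.c z a * (m k a * (f k z - f k a))) U
        (𝓝 (∑' a, W.c z a * (v z - v a))) := by
      refine tendsto_tsum_of_dominated_convergence hbound (fun a => ?_) ?_
      · refine Tendsto.const_mul _ ((hdiff z a).congr' ?_)
        filter_upwards [hm1 a] with k hk
        rw [hk, one_mul]
      · filter_upwards [hf] with k hk a
        rw [Real.norm_eq_abs, abs_mul, abs_of_nonneg (W.nonneg z a), abs_mul]
        refine mul_le_mul_of_nonneg_left ?_ (W.nonneg z a)
        calc |m k a| * |f k z - f k a| ≤ 1 * |f k z - f k a| :=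
              mul_le_mul_of_nonneg_right (hm k a) (abs_nonneg _)
          _ ≤ 2 * B := by rw [one_mul]; exact hsub (f k) hk a
    have hd : ∑' a, W.c z a * (v z - v a) = d z :=
      tendsto_nhds_unique hT (tendsto_const_nhds.congr' (by
        filter_upwards [hL z] with k hk using hk.symm))
    exact hd ▸ hsum.hasSum

theorem energy_sub_lt_top {u v : V → ℝ} (hu : W.energy u < ∞) (hv : W.energy v < ∞) :
    W.energy (fun z => u z - v z) < ∞ := by
  have key : W.energy (fun z => u z - v z) ≤ 2 * W.energy u + 2 * W.energy v := by
    simp only [energy]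
    rw [← mul_assoc, ← mul_assoc, mul_comm 2 (1 / 2 : ℝ≥0∞), mul_assoc, mul_assoc, ← mul_add]
    refine mul_le_mul_right ?_ _
    simp only [← ENNReal.tsum_mul_left, ← ENNReal.tsum_add]
    refine ENNReal.tsum_le_tsum fun a => ENNReal.tsum_le_tsum fun b => ?_
    rw [← ENNReal.ofReal_ofNat 2, ← ENNReal.ofReal_mul (by norm_num),
      ← ENNReal.ofReal_mul (by norm_num),
      ← ENNReal.ofReal_add (mul_nonneg (by norm_num) (mul_nonneg (W.nonneg _ _) (sq_nonneg _)))
        (mul_nonneg (by norm_num) (mul_nonneg (W.nonneg _ _) (sq_nonneg _)))]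
    refine ENNReal.ofReal_le_ofReal ?_
    nlinarith [mul_nonneg (W.nonneg a b) (sq_nonneg (u a - u b + (v a - v b)))]
  refine key.trans_lt (ENNReal.add_lt_top.2 ⟨?_, ?_⟩)
  · exact ENNReal.mul_lt_top (by simp) hu
  · exact ENNReal.mul_lt_top (by simp) hv

/-- Summable conductances give each vertex countably many neighbours, so by induction countably many
vertices have a walk of length `n` to `o`. -/
theorem countable_of_connected (hW : W.graph.Connected) : Countable V := by
  obtain ⟨o⟩ := hW.nonempty
  have hN : ∀ a, {b | W.graph.Adj a b}.Countable := fun a =>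
    (W.summable a).countable_support.mono fun b (hb : 0 < W.c a b) => hb.ne'
  have hA : ∀ n, {b | ∃ p : W.graph.Walk b o, p.length = n}.Countable := fun n => by
    induction n with
    | zero =>
      refine (Set.countable_singleton o).mono ?_
      rintro b ⟨p, hp⟩
      exact SimpleGraph.Walk.eq_of_length_eq_zero hp
    | succ n ih =>
      refine (ih.biUnion fun a _ => hN a).mono ?_
      rintro b ⟨p, hp⟩
      cases p with
      | nil => simp at hp
      | @cons _ a _ h p =>
        exact Set.mem_biUnion (x := a) ⟨p, by simpa using hp⟩ h.symm
  refine Set.countable_univ_iff.1 ((Set.countable_iUnion hA).mono fun b _ => ?_)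
  obtain ⟨p⟩ := hW.preconnected b o
  exact Set.mem_iUnion.2 ⟨p.length, p, rfl⟩

theorem nonempty_exhaustion (hW : W.graph.Connected) : Nonempty W.Exhaustion := by
  classical
  have := countable_of_connected hW
  have := hW.nonempty
  obtain ⟨e, he⟩ := exists_surjective_nat V
  have hext : ∀ (t : Finset V) (a : V), ∃ t' : Finset V, insert a t ⊆ t' ∧
      (W.graph.induce (t' : Set V)).Connected := fun t a =>
    SimpleGraph.extend_finset_to_connected hW.preconnected (Finset.insert_nonempty a t)
  choose F hF hFc using hext
  let G : ℕ → Finset V := fun n => Nat.rec (F ∅ (e 0)) (fun n t => F t (e (n + 1))) n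
  refine ⟨⟨G, monotone_nat_of_le_succ fun n => ?_, fun n => ?_, fun a => ?_⟩⟩
  · exact (Finset.subset_insert _ _).trans (hF (G n) (e (n + 1)))
  · cases n <;> exact hFc _ _
  · obtain ⟨n, rfl⟩ := he a
    refine ⟨n, ?_⟩
    cases n <;> exact hF _ _ (Finset.mem_insert_self _ _)

theorem Exhaustion.eventually_subset (G : W.Exhaustion) (s : Finset V) :
    ∀ᶠ k in atTop, s ⊆ G.verts k := by
  have h : ∀ a ∈ s, ∀ᶠ k in atTop, a ∈ G.verts k := fun a _ => by
    obtain ⟨n, hn⟩ := G.exhausts a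
    exact eventually_atTop.2 ⟨n, fun k hk => G.mono hk hn⟩
  exact (Finset.eventually_all s).2 h

theorem Exhaustion.eventually_mem (G : W.Exhaustion) (x : V) : ∀ᶠ k in atTop, x ∈ G.verts k := by
  simpa using G.eventually_subset {x}

/-- A bounded monotone function of connected finite vertex sets has a limit which is common to all
exhaustions. -/
theorem exists_tendsto_exhaustion {g : Finset V → ℝ} {x y : V} {B : ℝ}
    (hmono : ∀ H H' : Finset V, (W.graph.induce (H : Set V)).Connected →
      (W.graph.induce (H' : Set V)).Connected → H ⊆ H' → x ∈ H → y ∈ H → g H ≤ g H')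
    (hB : ∀ H : Finset V, (W.graph.induce (H : Set V)).Connected → x ∈ H → y ∈ H → g H ≤ B) :
    ∃ r, ∀ G : W.Exhaustion, Tendsto (fun k => g (G.verts k)) atTop (𝓝 r) := by
  -- The supremum of this set is the limit; no exhaustion enters its definition.
  let S := {r | ∃ H : Finset V, (W.graph.induce (H : Set V)).Connected ∧ x ∈ H ∧ y ∈ H ∧ g H = r}
  have hS : BddAbove S := ⟨B, by rintro _ ⟨H, hH, hx, hy, rfl⟩; exact hB H hH hx hy⟩
  refine ⟨sSup S, fun G => ?_⟩
  refine tendsto_order.2 ⟨fun a ha => ?_, fun a ha => ?_⟩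
  · obtain ⟨k₀, hk₀⟩ := ((G.eventually_mem x).and (G.eventually_mem y)).exists
    obtain ⟨_, ⟨H, hH, hx, hy, rfl⟩, hlt⟩ :=
      exists_lt_of_lt_csSup (s := S) ⟨_, _, G.connected k₀, hk₀.1, hk₀.2, rfl⟩ ha
    filter_upwards [G.eventually_subset H] with k hk
    exact hlt.trans_le (hmono H _ hH (G.connected k) hk hx hy)
  · filter_upwards [G.eventually_mem x, G.eventually_mem y] with k hx hy
    exact (le_csSup hS ⟨_, G.connected k, hx, hy, rfl⟩).trans_lt ha

end WeightedGraph

/-! ### The limiting resistances and the boundary resistance -/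

namespace WeightedGraph

variable {V : Type*} {W : WeightedGraph V}

theorem tendsto_freeResistance (x y : V) (G : W.Exhaustion) :
    Tendsto (fun k => W.freeResistanceOn (G.verts k) x y) atTop (𝓝 (W.freeResistance x y)) := by
  obtain ⟨r, hr⟩ := exists_tendsto_exhaustion (W := W) (x := x) (y := y) (B := 0)
    (g := fun H => -W.freeResistanceOn H x y)
    (fun H H' hH hH' hHH hx hy => neg_le_neg (freeResistanceOn_anti hH hH' hHH hx hy))
    (fun H hH hx hy => by
      rw [neg_nonpos, freeResistanceOn_eq hx hy]
      exact effectiveResistance_nonneg (free_graph_connected hH) _ _)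
  exact Classical.epsilon_spec (p := fun r : ℝ => ∀ G : W.Exhaustion,
    Tendsto (fun k => W.freeResistanceOn (G.verts k) x y) atTop (𝓝 r))
    ⟨-r, fun G => by simpa using (hr G).neg⟩ G

theorem tendsto_wiredResistance [Infinite V] (hW : W.graph.Connected) (x y : V) (G : W.Exhaustion) :
    Tendsto (fun k => W.wiredResistanceOn (G.verts k) x y) atTop (𝓝 (W.wiredResistance x y)) := by
  obtain ⟨k₀, hx₀, hy₀⟩ := ((G.eventually_mem x).and (G.eventually_mem y)).exists
  have hex := exists_tendsto_exhaustion (W := W) (x := x) (y := y)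
    (B := W.freeResistanceOn (G.verts k₀) x y) (g := fun H => W.wiredResistanceOn H x y)
    (fun H H' hH hH' hHH hx hy => wiredResistanceOn_mono hW hH hH' hHH hx hy)
    (fun H hH hx hy => by
      -- A set `G.verts k` containing both `H` and `G.verts k₀` links the wired resistance on `H` to
      -- the fixed free one on `G.verts k₀`.
      obtain ⟨k, hHk, hk⟩ :=
        ((G.eventually_subset H).and (G.eventually_subset (G.verts k₀))).exists
      exact (wiredResistanceOn_mono hW hH (G.connected k) hHk hx hy).trans
        ((wiredResistanceOn_le_freeResistanceOn hW (G.connected k) (hHk hx) (hHk hy)).trans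
          (freeResistanceOn_anti (G.connected k₀) (G.connected k) hk hx₀ hy₀)))
  exact Classical.epsilon_spec (p := fun r : ℝ => ∀ G : W.Exhaustion,
    Tendsto (fun k => W.wiredResistanceOn (G.verts k) x y) atTop (𝓝 r)) hex G

theorem wiredResistance_pos [Infinite V] (hW : W.graph.Connected) {x y : V} (hxy : x ≠ y) :
    0 < W.wiredResistance x y := by
  obtain ⟨G⟩ := nonempty_exhaustion hW
  obtain ⟨k₀, hx, hy⟩ := ((G.eventually_mem x).and (G.eventually_mem y)).exists
  refine (wiredResistanceOn_pos hW (G.connected k₀) hx hy hxy).trans_le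
    (ge_of_tendsto (tendsto_wiredResistance hW x y G) ?_)
  filter_upwards [eventually_ge_atTop k₀] with k hk
  exact wiredResistanceOn_mono hW (G.connected k₀) (G.connected k) (G.mono hk) hx hy

theorem wiredResistance_le_freeResistance [Infinite V] (hW : W.graph.Connected) (x y : V) :
    W.wiredResistance x y ≤ W.freeResistance x y := by
  obtain ⟨G⟩ := nonempty_exhaustion hW
  refine le_of_tendsto_of_tendsto (tendsto_wiredResistance hW x y G)
    (tendsto_freeResistance x y G) ?_
  filter_upwards [G.eventually_mem x, G.eventually_mem y] with k hx hy
  exact wiredResistanceOn_le_freeResistanceOn hW (G.connected k) hx hy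

open Classical in
/-- Unit voltages on the subnetworks of an exhaustion have a limit of finite energy. -/
theorem exists_limit_voltage {x y : V} (G : W.Exhaustion) {ρ : Finset V → ℝ} {r R : ℝ}
    {m : Finset V → V → ℝ} (hm : ∀ H z, |m H z| ≤ 1) (hm1 : ∀ H, ∀ z ∈ H, m H z = 1)
    (hρ : Tendsto (fun k => ρ (G.verts k)) atTop (𝓝 r))
    (hR : ∀ᶠ k in atTop, ρ (G.verts k) ≤ R)
    (h : ∀ H : Finset V, (W.graph.induce (H : Set V)).Connected → x ∈ H → y ∈ H →
      ∃ f : V → ℝ, f x - f y = ρ H ∧ (∀ z, |f z| ≤ ρ H) ∧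
        ∑ p ∈ H ×ˢ H, W.c p.1 p.2 * (f p.1 - f p.2) ^ 2 ≤ 2 * ρ H ∧
        ∀ z ∈ H, ∑' a, W.c z a * (m H a * (f z - f a)) =
          (if z = x then 1 else 0) - (if z = y then 1 else 0)) :
    ∃ v : V → ℝ, v x - v y = r ∧ W.energy v < ∞ ∧
      ∀ z, HasSum (fun a => W.c z a * (v z - v a))
        ((if z = x then 1 else 0) - (if z = y then 1 else 0)) := by
  have h' : ∀ k, ∃ f : V → ℝ, x ∈ G.verts k → y ∈ G.verts k →
      (f x - f y = ρ (G.verts k) ∧ (∀ z, |f z| ≤ ρ (G.verts k)) ∧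
        ∑ p ∈ G.verts k ×ˢ G.verts k, W.c p.1 p.2 * (f p.1 - f p.2) ^ 2 ≤ 2 * ρ (G.verts k) ∧
        ∀ z ∈ G.verts k, ∑' a, W.c z a * (m (G.verts k) a * (f z - f a)) =
          (if z = x then 1 else 0) - (if z = y then 1 else 0)) := fun k => by
    by_cases hk : x ∈ G.verts k ∧ y ∈ G.verts k
    · obtain ⟨f, hf⟩ := h _ (G.connected k) hk.1 hk.2
      exact ⟨f, fun _ _ => hf⟩
    · exact ⟨0, fun hx hy => absurd ⟨hx, hy⟩ hk⟩
  choose f hf using h'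
  have hU : (Ultrafilter.of (atTop : Filter ℕ) : Filter ℕ) ≤ atTop := Ultrafilter.of_le _
  have hmem := (G.eventually_mem x).and (G.eventually_mem y)
  -- The bound `2 * R` serves twice: the values are at most `R`, and the sum over ordered pairs,
  -- twice an energy, is at most `2 * R`.
  obtain ⟨v, hv, hvE, hvL⟩ := exists_limit (W := W) (Ultrafilter.of atTop) (f := f)
    (m := fun k => m (G.verts k)) (B := 2 * R)
    (d := fun z => (if z = x then 1 else 0) - (if z = y then 1 else 0))
    (by
      refine hU ?_
      filter_upwards [hmem, hR] with k hk hRk z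
      have h1 := (hf k hk.1 hk.2).2.1 z
      linarith [abs_nonneg (f k z)])
    (fun k z => hm _ z)
    (fun z => hU ((G.eventually_mem z).mono fun k hk => hm1 _ _ hk))
    (fun s => by
      refine hU ?_
      filter_upwards [hmem, hR, G.eventually_subset (s.image Prod.fst),
        G.eventually_subset (s.image Prod.snd)] with k hk hRk h1 h2
      refine le_trans ?_ (((hf k hk.1 hk.2).2.2.1).trans (by linarith))
      refine Finset.sum_le_sum_of_subset_of_nonneg (fun p hp => ?_)
        fun p _ _ => mul_nonneg (W.nonneg _ _) (sq_nonneg _)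
      exact Finset.mem_product.2
        ⟨h1 (Finset.mem_image_of_mem _ hp), h2 (Finset.mem_image_of_mem _ hp)⟩)
    (fun z => by
      refine hU ?_
      filter_upwards [hmem, G.eventually_mem z] with k hk hz
      exact (hf k hk.1 hk.2).2.2.2 z hz)
  refine ⟨v, tendsto_nhds_unique ((hv x).sub (hv y)) ((hρ.mono_left hU).congr' ?_), hvE, hvL⟩
  exact hU (hmem.mono fun k hk => (hf k hk.1 hk.2).1.symm)

theorem freeResistance_eq_wiredResistance [Infinite V] (hW : W.graph.Connected)
    (hharm : ∀ h ∈ W.harm, ∃ a : ℝ, ∀ z, h z = a) (x y : V) :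
    W.freeResistance x y = W.wiredResistance x y := by
  classical
  obtain ⟨G⟩ := nonempty_exhaustion hW
  obtain ⟨u, huR, huE, huL⟩ := exists_limit_voltage G (ρ := fun H => W.freeResistanceOn H x y)
    (m := fun H a => if a ∈ H then 1 else 0) (R := W.freeResistance x y + 1)
    (fun H z => by split_ifs <;> simp) (fun H z hz => if_pos hz)
    (tendsto_freeResistance x y G)
    ((tendsto_freeResistance x y G).eventually_le_const (by linarith))
    (fun H hH hx hy => exists_free_voltage hH hx hy)
  obtain ⟨v, hvR, hvE, hvL⟩ := exists_limit_voltage G (ρ := fun H => W.wiredResistanceOn H x y)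
    (m := fun H a => 1) (R := W.wiredResistance x y + 1)
    (fun H z => by simp) (fun H z hz => rfl)
    (tendsto_wiredResistance hW x y G)
    ((tendsto_wiredResistance hW x y G).eventually_le_const (by linarith))
    (fun H hH hx hy => exists_wired_voltage hW hH hx hy)
  -- The two limit voltages have the same Laplacian, so their difference is harmonic of finite
  -- energy.
  obtain ⟨a, ha⟩ := hharm (fun z => u z - v z) ⟨energy_sub_lt_top huE hvE, fun z => by
    have := ((huL z).sub (hvL z)).tsum_eq
    rw [sub_self] at this
    rw [← this]
    exact tsum_congr fun b => by ring⟩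
  have hx := ha x
  have hy := ha y
  linarith

theorem boundaryResistance_eq [Infinite V] (hW : W.graph.Connected) {x y : V} (hxy : x ≠ y) :
    W.boundaryResistance x y =
      ENNReal.ofReal (W.wiredResistance x y * W.freeResistance x y) /
        ENNReal.ofReal (W.harmonicResistance x y) := by
  have hw := wiredResistance_pos hW hxy
  have hf := hw.trans_le (wiredResistance_le_freeResistance hW x y)
  rw [boundaryResistance, harmonicResistance, inv_sub_inv hw.ne' hf.ne',
    ENNReal.ofReal_div_of_pos (mul_pos hw hf),
    ENNReal.inv_div (Or.inl ENNReal.ofReal_ne_top)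
      (Or.inl (ENNReal.ofReal_pos.2 (mul_pos hw hf)).ne')]

end WeightedGraph

theorem mainTheorem4 {V : Type*} [Infinite V] (N : ResistanceNetwork V) :
    Nonempty N.Exhaustion ∧
    ∀ x y : V, x ≠ y →
      (∀ G : N.Exhaustion,
        Tendsto (fun k => N.freeResistanceOn (G.verts k) x y) atTop
          (𝓝 (N.freeResistance x y))) ∧
      (∀ G : N.Exhaustion,
        Tendsto (fun k => N.wiredResistanceOn (G.verts k) x y) atTop
          (𝓝 (N.wiredResistance x y))) ∧
      0 < N.wiredResistance x y ∧
      N.wiredResistance x y ≤ N.freeResistance x y ∧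
      N.boundaryResistance x y =
        ENNReal.ofReal (N.wiredResistance x y * N.freeResistance x y) /
          ENNReal.ofReal (N.harmonicResistance x y) ∧
      ((∀ h ∈ N.harm, ∃ a : ℝ, ∀ z, h z = a) → N.boundaryResistance x y = ∞) := by
  have hN := N.connected
  refine ⟨WeightedGraph.nonempty_exhaustion hN, fun x y hxy =>
    ⟨WeightedGraph.tendsto_freeResistance x y, WeightedGraph.tendsto_wiredResistance hN x y,
      WeightedGraph.wiredResistance_pos hN hxy,
      WeightedGraph.wiredResistance_le_freeResistance hN x y,
      WeightedGraph.boundaryResistance_eq hN hxy, fun hharm => ?_⟩⟩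
  rw [WeightedGraph.boundaryResistance,
    WeightedGraph.freeResistance_eq_wiredResistance hN hharm x y, sub_self, ENNReal.ofReal_zero,
    ENNReal.inv_zero]
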